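/- Let $\delta>-1$. On a probability space let $\{BI_i(t):t\ge 0\}_{i\ge 1}$ be independent continuous-time Markov pure birth processes (with right-continuous paths) on the positive integers with transition rates $q_{j,j+1}=j+\delta$ (birth processes with immigration), started from $BI_1(0)=2$ and $BI_i(0)=1$ for $i\ge 2$. Let $0<\tau^{(i)}_1<\tau^{(i)}_2<\cdots$ be the jump times of $BI_i$. Define the branching times of Model A by $T^A_1=0$ and, for $n\ge 1$, $$T^A_{n+1}=\min\{T^A_i+\tau^{(i)}_k:\ k\ge 1,\ 1\le i\le n,\ T^A_i+\tau^{(i)}_k>T^A_n\},$$ and the branching times of Model B by $T^B_0=T^B_1=0$ and, for $n\ge 1$, $$T^B_{n+1}=\min\{T^B_{i-1}+\tau^{(i)}_k:\ k\ge 1,\ 1\le i\le n+1,\ T^B_{i-1}+\tau^{(i)}_k>T^B_n\}.$$ Then there are random variables $W_A\sim\mathrm{Exp}(1)$ and $W_B\sim\mathrm{Gamma}\left(\frac{3+2\delta}{2+\delta},1\right)$ (shape $\frac{3+2\delta}{2+\delta}$, rate $1$) such that, as $n\to\infty$, $$\frac{n}{e^{(2+\delta)T^A_n}}\longrightarrow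 W_A\quad\text{almost surely},\qquad \frac{n}{e^{(2+\delta)T^B_n}}\longrightarrow W_B\quad\text{almost surely}.$$ -/

import Mathlib

open MeasureTheory ProbabilityTheory Filter Topology
open scoped NNReal

namespace BranchingTimes

/-- The successive jump times `τ₀ = 0 < τ₁ < τ₂ < …` of a path `x : [0, ∞) → ℕ`:
`τ_{k+1} = inf {t ≥ τ_k : x t ≠ x τ_k}`. -/
noncomputable def jumpTime (x : ℝ≥0 → ℕ) : ℕ → ℝ≥0
  | 0 => 0
  | k + 1 => sInf {t : ℝ≥0 | jumpTime x k ≤ t ∧ x t ≠ x (jumpTime x k)}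

/-- `X` is a (continuous-time Markov) pure birth process started at `a` with transition rates
`q_{j,j+1} = q j`, in the jump chain / holding time form: the paths are right-continuous, the
chain goes up by one at every jump, and the successive holding times are independent, the one
in state `j` being exponential with rate `q j`. -/
structure IsBirthProcess {Ω : Type*} [MeasurableSpace Ω] (P : Measure Ω)
    (X : ℝ≥0 → Ω → ℕ) (a : ℕ) (q : ℕ → ℝ) : Prop where
  measurable : ∀ t, Measurable (X t)
  initial : ∀ᵐ ω ∂P, X 0 ω = a
  rightContinuous : ∀ᵐ ω ∂P, ∀ t : ℝ≥0,
    ContinuousWithinAt (fun s : ℝ≥0 => X s ω) (Set.Ici t) t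
  jumpChain : ∀ᵐ ω ∂P, ∀ k : ℕ, X (jumpTime (fun s => X s ω) k) ω = a + k
  holding_law : ∀ k : ℕ,
    HasLaw (fun ω => (jumpTime (fun s => X s ω) (k + 1) : ℝ) - jumpTime (fun s => X s ω) k)
      (expMeasure (q (a + k))) P
  holding_indep :
    iIndepFun (fun (k : ℕ) ω =>
      (jumpTime (fun s => X s ω) (k + 1) : ℝ) - jumpTime (fun s => X s ω) k) P

/-- `X` is a birth process with immigration (B.I. process) with unit lifetime parameter and
immigration parameter `δ`, started at `a`: its transition rates are `q_{j,j+1} = j + δ`. -/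
def IsBIProcess {Ω : Type*} [MeasurableSpace Ω] (P : Measure Ω)
    (X : ℝ≥0 → Ω → ℕ) (a : ℕ) (δ : ℝ) : Prop :=
  IsBirthProcess P X a (fun j => (j : ℝ) + δ)

/-- The branching times of Model A, for paths `x i` (`i = 1, 2, …`) with jump times `τ^{(i)}_k`:
`T₁ = 0`, and for `n ≥ 1`
`T_{n+1} = min {T_i + τ^{(i)}_k : k ≥ 1, 1 ≤ i ≤ n, T_i + τ^{(i)}_k > T_n}`.
The value at index `0` is a dummy. -/
noncomputable def branchTimeA (x : ℕ+ → ℝ≥0 → ℕ) : ℕ → ℝ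
  | 0 => 0
  | 1 => 0
  | n + 2 => sInf {t : ℝ | ∃ i : ℕ+, ∃ _ : (i : ℕ) ≤ n + 1, ∃ k : ℕ, 1 ≤ k ∧
      t = branchTimeA x (i : ℕ) + jumpTime (x i) k ∧ branchTimeA x (n + 1) < t}
  termination_by n => n
  decreasing_by all_goals omega

/-- The branching times of Model B, for paths `x i` (`i = 1, 2, …`) with jump times `τ^{(i)}_k`:
`T₀ = T₁ = 0`, and for `n ≥ 1`
`T_{n+1} = min {T_{i-1} + τ^{(i)}_k : k ≥ 1, 1 ≤ i ≤ n + 1, T_{i-1} + τ^{(i)}_k > T_n}`. -/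
noncomputable def branchTimeB (x : ℕ+ → ℝ≥0 → ℕ) : ℕ → ℝ
  | 0 => 0
  | 1 => 0
  | n + 2 => sInf {t : ℝ | ∃ i : ℕ+, ∃ _ : (i : ℕ) ≤ n + 2, ∃ k : ℕ, 1 ≤ k ∧
      t = branchTimeB x ((i : ℕ) - 1) + jumpTime (x i) k ∧ branchTimeB x (n + 1) < t}
  termination_by n => n
  decreasing_by
    · have := i.pos
      omega
    · omega

end BranchingTimes

/-!
In both models the clocks running at a given time are independent exponential variables. By lack of
memory this persists after every birth, with residual clocks in place of the original ones: the
parent's rate goes up by one and the rates of the others do not change. Hence the gaps between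
successive births are independent and exponential, and the sum of the rates just before the next
birth is `(2 + δ) (s + j)` after `j` births, with `s = 1` in Model A and `s = (3 + 2 δ) / (2 + δ)`
in Model B.

For independent gaps `D j` of rates `c (s + j)`, the products of the variables
`(s + j + 1) / (s + j) * exp (-c * D j)` form a positive martingale, and telescoping the rational
factors turns its almost sure convergence into that of `n / exp (c T)`. The characteristic function
of `log n - c T` is a quotient `GammaSeq (s + i t) n / GammaSeq s n` of Euler sequences, which tends
to `Γ (s + i t) / Γ s`, the characteristic function of the logarithm of a `Gamma (s, 1)` variable.
-/

namespace BranchingTimes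

/-! ### Exponential and gamma laws -/

section GammaLaw

lemma ae_pos_gammaMeasure (a r : ℝ) : ∀ᵐ x ∂gammaMeasure a r, 0 < x := by
  have measure_Iic : gammaMeasure a r (Set.Iic 0) = 0 := by
    rw [gammaMeasure, withDensity_apply _ measurableSet_Iic, setLIntegral_congr Iio_ae_eq_Iic.symm]
    exact lintegral_gammaPDF_of_nonpos le_rfl
  rw [ae_iff]
  simpa only [not_lt] using! measure_Iic

lemma ae_pos_expMeasure (r : ℝ) : ∀ᵐ x ∂expMeasure r, 0 < x :=
  ae_pos_gammaMeasure 1 r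

lemma measurable_exponentialPDF (r : ℝ) : Measurable (exponentialPDF r) :=
  (measurable_exponentialPDFReal r).ennreal_ofReal

lemma expMeasure_apply (r : ℝ) {s : Set ℝ} (hs : MeasurableSet s) :
    expMeasure r s = ∫⁻ x in s, exponentialPDF r x :=
  withDensity_apply _ hs

lemma expMeasure_setOf_lt_and_sub_mem (r : ℝ) {t : ℝ} (ht : 0 ≤ t) {s : Set ℝ}
    (hs : MeasurableSet s) :
    expMeasure r {x | t < x ∧ x - t ∈ s} =
      ENNReal.ofReal (Real.exp (-(r * t))) * expMeasure r s := by
  have hE : MeasurableSet {x | t < x ∧ x - t ∈ s} :=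
    measurableSet_Ioi.inter (hs.preimage (measurable_id.sub_const t))
  rw [expMeasure_apply r hE, expMeasure_apply r hs,
    ← lintegral_const_mul _ (measurable_exponentialPDF r), ← lintegral_indicator hE,
    ← lintegral_indicator hs, ← lintegral_add_right_eq_self _ t]
  refine lintegral_congr_ae ?_
  filter_upwards [Measure.ae_ne volume 0] with y hy
  classical
  simp only [Set.indicator_apply, Set.mem_ofPred_eq, lt_add_iff_pos_left, add_sub_cancel_right]
  rcases hy.lt_or_gt with hneg | hpos
  · simp [exponentialPDF_of_neg hneg, hneg.not_gt]
  · rw [exponentialPDF_of_nonneg hpos.le, exponentialPDF_of_nonneg (by positivity),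
      ← ENNReal.ofReal_mul (Real.exp_nonneg _), mul_left_comm, ← Real.exp_add, mul_add,
      neg_add_rev]
    simp only [hpos, true_and]

lemma setLIntegral_exp_neg_mul_expMeasure {r q : ℝ} (hr : 0 ≤ r) (hrq : 0 < r + q) {s : Set ℝ}
    (hs : MeasurableSet s) :
    ∫⁻ t in s, ENNReal.ofReal (Real.exp (-(q * t))) ∂expMeasure r =
      ENNReal.ofReal (r / (r + q)) * expMeasure (r + q) s := by
  rw [expMeasure_apply _ hs, expMeasure, gammaMeasure,
    setLIntegral_withDensity_eq_setLIntegral_mul (f := gammaPDF 1 r) _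
      (measurable_exponentialPDF r) (by fun_prop) hs,
    ← lintegral_const_mul _ (measurable_exponentialPDF _)]
  congr 1 with t
  change exponentialPDF r t * _ = _
  rcases lt_or_ge t 0 with ht | ht
  · simp only [exponentialPDF_of_neg ht, zero_mul, mul_zero]
  · rw [exponentialPDF_of_nonneg ht, exponentialPDF_of_nonneg ht,
      ← ENNReal.ofReal_mul' (Real.exp_nonneg _), ← ENNReal.ofReal_mul (by positivity), mul_assoc,
      ← Real.exp_add, ← mul_assoc, div_mul_cancel₀ _ hrq.ne']
    ring_nf

lemma integral_gammaMeasure {a r : ℝ} (ha : 0 < a) (hr : 0 < r) (f : ℝ → ℂ) :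
    ∫ x, f x ∂gammaMeasure a r = ∫ x in Set.Ioi (0 : ℝ),
      ((r ^ a / Real.Gamma a * x ^ (a - 1) * Real.exp (-(r * x)) : ℝ) : ℂ) * f x := by
  have hpdf : Measurable (gammaPDF a r) := (measurable_gammaPDFReal a r).ennreal_ofReal
  rw [gammaMeasure, integral_withDensity_eq_integral_toReal_smul hpdf
    (Eventually.of_forall fun _ => ENNReal.ofReal_lt_top), ← integral_Ici_eq_integral_Ioi,
    ← integral_indicator measurableSet_Ici]
  congr 1 with x
  by_cases hx : 0 ≤ x
  · rw [Set.indicator_of_mem (Set.mem_Ici.2 hx), gammaPDF_of_nonneg hx, ENNReal.toReal_ofReal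
      (by have := Real.Gamma_pos_of_pos ha; positivity), Complex.real_smul]
  · rw [Set.indicator_of_notMem (Set.notMem_Ici.2 (not_le.1 hx)), gammaPDF_of_neg (not_le.1 hx),
      ENNReal.toReal_zero, zero_smul]

lemma integral_cexp_neg_mul_expMeasure {r : ℝ} (hr : 0 < r) {z : ℂ} (hz : -r < z.re) :
    ∫ x : ℝ, Complex.exp (-z * x) ∂expMeasure r = r / (r + z) := by
  have hre : (-((r : ℂ) + z)).re < 0 := by
    rw [Complex.neg_re, Complex.add_re, Complex.ofReal_re]
    linarith
  have density_mul : ∀ x : ℝ,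
      ((r ^ (1 : ℝ) / Real.Gamma 1 * x ^ ((1 : ℝ) - 1) * Real.exp (-(r * x)) : ℝ) : ℂ) *
        Complex.exp (-z * x) = r * Complex.exp (-((r : ℂ) + z) * x) := fun x => by
    rw [Real.rpow_one, Real.Gamma_one, sub_self, Real.rpow_zero, div_one, mul_one]
    push_cast
    rw [mul_assoc, ← Complex.exp_add]
    ring_nf
  rw [expMeasure, integral_gammaMeasure one_pos hr]
  simp only [density_mul]
  rw [integral_const_mul, integral_exp_mul_complex_Ioi hre 0, Complex.ofReal_zero, mul_zero,
    Complex.exp_zero, neg_div_neg_eq, mul_one_div]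

lemma charFun_expMeasure {r : ℝ} (hr : 0 < r) (t : ℝ) :
    charFun (expMeasure r) t = r / (r - t * Complex.I) := by
  have h := integral_cexp_neg_mul_expMeasure hr (z := -(t * Complex.I)) (by simpa using hr)
  rw [charFun_apply_real, sub_eq_add_neg, ← h]
  simp only [neg_neg, mul_right_comm]

lemma integral_exp_neg_mul_expMeasure {r c : ℝ} (hr : 0 < r) (hc : -r < c) :
    ∫ x : ℝ, Real.exp (-c * x) ∂expMeasure r = r / (r + c) := by
  have h := integral_cexp_neg_mul_expMeasure hr (z := c) (by simpa using hc)
  rw [← Complex.ofReal_inj, ← integral_complex_ofReal]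
  push_cast
  exact h

lemma integral_cpow_gammaMeasure {a r : ℝ} (ha : 0 < a) (hr : 0 < r) {w : ℂ} (hw : -a < w.re) :
    ∫ x : ℝ, (x : ℂ) ^ w ∂gammaMeasure a r =
      Complex.Gamma (a + w) / Complex.Gamma a / (r : ℂ) ^ w := by
  have hr' : (r : ℂ) ≠ 0 := Complex.ofReal_ne_zero.2 hr.ne'
  have hre : 0 < (a + w : ℂ).re := by
    rw [Complex.add_re, Complex.ofReal_re]
    linarith
  have density_mul : ∀ x ∈ Set.Ioi (0 : ℝ),
      ((r ^ a / Real.Gamma a * x ^ (a - 1) * Real.exp (-(r * x)) : ℝ) : ℂ) * (x : ℂ) ^ w =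
        (r : ℂ) ^ (a : ℂ) / Complex.Gamma a *
          ((x : ℂ) ^ (a + w - 1) * Complex.exp (-(r * x))) := fun x hx => by
    have hx' : (x : ℂ) ≠ 0 := Complex.ofReal_ne_zero.2 (ne_of_gt hx)
    rw [add_sub_right_comm, Complex.cpow_add _ _ hx', Complex.Gamma_ofReal]
    push_cast [Complex.ofReal_cpow hr.le, Complex.ofReal_cpow (le_of_lt hx)]
    ring_nf
  rw [integral_gammaMeasure ha hr, setIntegral_congr_fun measurableSet_Ioi density_mul,
    integral_const_mul, Complex.integral_cpow_mul_exp_neg_mul_Ioi hre (by simpa using hr), one_div,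
    Complex.inv_cpow _ _ (by simp [Complex.arg_ofReal_of_nonneg hr.le, Real.pi_ne_zero.symm]),
    Complex.cpow_add _ _ hr']
  have : (r : ℂ) ^ (a : ℂ) ≠ 0 := by simp [Complex.cpow_eq_zero_iff, hr']
  field_simp

lemma charFun_map_log_gammaMeasure {a : ℝ} (ha : 0 < a) (t : ℝ) :
    charFun ((gammaMeasure a 1).map Real.log) t =
      Complex.Gamma (a + t * Complex.I) / Complex.Gamma a := by
  have h := integral_cpow_gammaMeasure ha one_pos (w := t * Complex.I) (by simpa using ha)
  rw [Complex.ofReal_one, Complex.one_cpow, div_one] at h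
  rw [charFun_apply_real, integral_map Real.measurable_log.aemeasurable (by fun_prop), ← h]
  refine integral_congr_ae ?_
  filter_upwards [ae_pos_gammaMeasure a 1] with x hx
  rw [Complex.cpow_def_of_ne_zero (Complex.ofReal_ne_zero.2 hx.ne'), ← Complex.ofReal_log hx.le]
  ring_nf

lemma map_exp_map_log_gammaMeasure (a r : ℝ) :
    ((gammaMeasure a r).map Real.log).map Real.exp = gammaMeasure a r := by
  have exp_log : Real.exp ∘ Real.log =ᵐ[gammaMeasure a r] id :=
    (ae_pos_gammaMeasure a r).mono fun _ hx => Real.exp_log hx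
  rw [Measure.map_map Real.measurable_exp Real.measurable_log, Measure.map_congr exp_log,
    Measure.map_id]

end GammaLaw

/-! ### Families of exponential clocks -/

section ProductMeasure

variable {ι : Type*} [DecidableEq ι] {X : ι → Type*} [∀ i, MeasurableSpace (X i)]

lemma map_update_infinitePi_prod (ν : ∀ i, Measure (X i)) [∀ i, IsProbabilityMeasure (ν i)]
    (i : ι) :
    ((Measure.infinitePi ν).prod (ν i)).map (fun q => Function.update q.1 i q.2) =
      Measure.infinitePi ν := by
  refine Measure.eq_infinitePi _ fun s T hT => ?_
  rw [Measure.map_apply measurable_update' (.pi s.countable_toSet fun j _ => hT j)]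
  have preimage_pi : (fun q : (∀ j, X j) × X i => Function.update q.1 i q.2) ⁻¹'
      Set.pi (s : Set ι) T =
      Set.pi ((s.erase i : Finset ι) : Set ι) T ×ˢ (if i ∈ s then T i else Set.univ) := by
    ext ⟨y, t⟩
    simp only [Set.mem_preimage, Set.mem_pi, Set.mem_prod, Finset.mem_coe, Finset.mem_erase]
    constructor
    · refine fun h => ⟨fun j hj => by simpa [hj.1] using h j hj.2, ?_⟩
      by_cases hi : i ∈ s
      · simpa [hi] using h i hi
      · simp [hi]
    · rintro ⟨hy, ht⟩ j hj
      rcases eq_or_ne j i with rfl | hne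
      · simpa [hj] using ht
      · simpa [hne] using hy j ⟨hne, hj⟩
  rw [preimage_pi, Measure.prod_prod, Measure.infinitePi_pi _ fun j _ => hT j]
  by_cases hi : i ∈ s
  · simp [hi, Finset.prod_erase_mul s (fun j => ν j (T j)) hi]
  · simp [hi]

variable (ν : ∀ i, Measure (X i)) [∀ i, IsProbabilityMeasure (ν i)] (i : ι) {E : Set (∀ i, X i)}

lemma infinitePi_apply_eq_lintegral (hE : MeasurableSet E) :
    Measure.infinitePi ν E =
      ∫⁻ y, ν i {t | Function.update y i t ∈ E} ∂Measure.infinitePi ν := by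
  conv_lhs => rw [← map_update_infinitePi_prod ν i]
  rw [Measure.map_apply measurable_update' hE, Measure.prod_apply (measurable_update' hE)]
  rfl

lemma infinitePi_apply_eq_lintegral_symm (hE : MeasurableSet E) :
    Measure.infinitePi ν E =
      ∫⁻ t, Measure.infinitePi ν {y | Function.update y i t ∈ E} ∂ν i := by
  conv_lhs => rw [← map_update_infinitePi_prod ν i]
  rw [Measure.map_apply measurable_update' hE, Measure.prod_apply_symm (measurable_update' hE)]
  rfl

end ProductMeasure

section ExponentialClocks

variable {ι : Type*}

lemma measurableSet_forall_lt (s : Finset ι) {f : (ι → ℝ) → ℝ} (hf : Measurable f) :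
    MeasurableSet {z : ι → ℝ | ∀ l ∈ s, f z < z l} := by
  have : {z : ι → ℝ | ∀ l ∈ s, f z < z l} = ⋂ l ∈ s, {z | f z < z l} := by
    ext
    simp only [Set.mem_ofPred_eq, Set.mem_iInter]
  rw [this]
  exact s.measurableSet_biInter fun l _ => measurableSet_lt hf (measurable_pi_apply l)

variable [DecidableEq ι] {r : ι → ℝ}

/-- The clocks `z` seen at time `t`, when only the clocks in `s` are running. -/
def shiftOn (s : Finset ι) (t : ℝ) (z : ι → ℝ) : ι → ℝ :=
  fun i => if i ∈ s then z i - t else z i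

lemma shiftOn_insert {s : Finset ι} {i : ι} (hi : i ∉ s) (t : ℝ) (z : ι → ℝ) :
    shiftOn (insert i s) t z =
      Function.update (shiftOn s t z) i (shiftOn s t z i - t) := by
  ext j
  rcases eq_or_ne j i with rfl | hj
  · simp [shiftOn, hi]
  · simp [shiftOn, hj]

@[fun_prop]
lemma measurable_shiftOn (s : Finset ι) : Measurable fun q : ℝ × (ι → ℝ) => shiftOn s q.1 q.2 :=
  measurable_pi_lambda _ fun i => by
    unfold shiftOn
    split_ifs <;> fun_prop

lemma infinitePi_expMeasure_setOf_lt_and_update_sub_mem (hr : ∀ i, 0 < r i) (i : ι) {t : ℝ}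
    (ht : 0 ≤ t) {B : Set (ι → ℝ)} (hB : MeasurableSet B) :
    Measure.infinitePi (fun j => expMeasure (r j))
        {z | t < z i ∧ Function.update z i (z i - t) ∈ B} =
      ENNReal.ofReal (Real.exp (-(r i * t))) *
        Measure.infinitePi (fun j => expMeasure (r j)) B := by
  have := fun j => isProbabilityMeasure_expMeasure (hr j)
  have hE : MeasurableSet {z : ι → ℝ | t < z i ∧ Function.update z i (z i - t) ∈ B} :=
    (measurableSet_lt measurable_const (measurable_pi_apply i)).inter
      (hB.preimage (measurable_update'.comp (measurable_id.prodMk (by fun_prop))))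
  rw [infinitePi_apply_eq_lintegral _ i hE, infinitePi_apply_eq_lintegral _ i hB,
    ← lintegral_const_mul' _ _ ENNReal.ofReal_ne_top]
  congr 1 with y
  simp only [Set.mem_ofPred_eq, Function.update_self, Function.update_idem]
  exact expMeasure_setOf_lt_and_sub_mem (r i) ht (hB.preimage (measurable_update y))

lemma infinitePi_expMeasure_setOf_lt_and_shiftOn_mem (hr : ∀ i, 0 < r i) (s : Finset ι) {t : ℝ}
    (ht : 0 ≤ t) {B : Set (ι → ℝ)} (hB : MeasurableSet B) :
    Measure.infinitePi (fun i => expMeasure (r i)) {z | (∀ l ∈ s, t < z l) ∧ shiftOn s t z ∈ B} =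
      ENNReal.ofReal (Real.exp (-((∑ l ∈ s, r l) * t))) *
        Measure.infinitePi (fun i => expMeasure (r i)) B := by
  induction s using Finset.induction_on generalizing B with
  | empty =>
    have shiftOn_empty : ∀ z : ι → ℝ, shiftOn ∅ t z = z := fun z => by
      ext
      simp [shiftOn]
    simp [shiftOn_empty]
  | insert i s hi ih =>
    have peel_clock : {z : ι → ℝ | (∀ l ∈ insert i s, t < z l) ∧ shiftOn (insert i s) t z ∈ B} =
        {z | (∀ l ∈ s, t < z l) ∧
          shiftOn s t z ∈ {w | t < w i ∧ Function.update w i (w i - t) ∈ B}} := by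
      ext z
      simp only [Finset.forall_mem_insert, Set.mem_ofPred_eq, shiftOn_insert hi]
      simp only [shiftOn, hi, if_false]
      tauto
    have hB' : MeasurableSet {w : ι → ℝ | t < w i ∧ Function.update w i (w i - t) ∈ B} :=
      (measurableSet_lt measurable_const (measurable_pi_apply i)).inter
        (hB.preimage (measurable_update'.comp (measurable_id.prodMk (by fun_prop))))
    rw [peel_clock, ih hB', infinitePi_expMeasure_setOf_lt_and_update_sub_mem hr i ht hB,
      ← mul_assoc, ← ENNReal.ofReal_mul (Real.exp_nonneg _), ← Real.exp_add,
      Finset.sum_insert hi]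
    ring_nf

lemma infinitePi_expMeasure_setOf_update_race (hr : ∀ i, 0 < r i) {i : ι} {s : Finset ι}
    (hi : i ∉ s) {κ : Type*} {σ : κ → ι} (hσ : Function.Injective σ) (hσi : ∀ k, σ k ≠ i) {t : ℝ}
    (ht : 0 ≤ t) {B : Set (κ → ℝ)} (hB : MeasurableSet B) :
    Measure.infinitePi (fun j => expMeasure (r j))
        {y | (∀ l ∈ s, t < Function.update y i t l) ∧
          shiftOn s t (Function.update y i t) ∘ σ ∈ B} =
      ENNReal.ofReal (Real.exp (-((∑ l ∈ s, r l) * t))) *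
        Measure.infinitePi (fun k => expMeasure (r (σ k))) B := by
  have := fun j => isProbabilityMeasure_expMeasure (hr j)
  have hcomp : Measurable fun z : ι → ℝ => z ∘ σ := by fun_prop
  have forget_clock : ∀ y : ι → ℝ, (∀ l ∈ s, t < Function.update y i t l) ∧
      shiftOn s t (Function.update y i t) ∘ σ ∈ B ↔
      (∀ l ∈ s, t < y l) ∧ shiftOn s t y ∈ (fun z => z ∘ σ) ⁻¹' B := fun y => by
    have hs : ∀ l ∈ s, Function.update y i t l = y l := fun l hl =>
      Function.update_of_ne (ne_of_mem_of_not_mem hl hi) _ _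
    have hshift : shiftOn s t (Function.update y i t) ∘ σ = shiftOn s t y ∘ σ := by
      ext k
      simp only [shiftOn, Function.comp_apply, Function.update_of_ne (hσi k)]
    rw [hshift, Set.mem_preimage]
    exact and_congr_left' (forall₂_congr fun l hl => by rw [hs l hl])
  simp only [forget_clock]
  rw [infinitePi_expMeasure_setOf_lt_and_shiftOn_mem hr s ht (hcomp hB),
    ← Measure.map_apply hcomp hB]
  congr 2
  exact Measure.map_infinitePi_infinitePi_of_inj hσ

theorem infinitePi_expMeasure_race (hr : ∀ i, 0 < r i) {i : ι} {s : Finset ι} (hi : i ∉ s)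
    {κ : Type*} {σ : κ → ι} (hσ : Function.Injective σ) (hσi : ∀ k, σ k ≠ i)
    {A : Set ℝ} (hA : MeasurableSet A) {B : Set (κ → ℝ)} (hB : MeasurableSet B) :
    Measure.infinitePi (fun j => expMeasure (r j))
        {z | z i ∈ A ∧ (∀ l ∈ s, z i < z l) ∧ shiftOn s (z i) z ∘ σ ∈ B} =
      ENNReal.ofReal (r i / (r i + ∑ l ∈ s, r l)) * expMeasure (r i + ∑ l ∈ s, r l) A *
        Measure.infinitePi (fun k => expMeasure (r (σ k))) B := by
  have := fun j => isProbabilityMeasure_expMeasure (hr j)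
  have hshift : Measurable fun z : ι → ℝ => shiftOn s (z i) z ∘ σ :=
    measurable_pi_lambda _ fun k => (measurable_pi_apply (σ k)).comp
      ((measurable_shiftOn s).comp (g := fun q : ℝ × (ι → ℝ) => shiftOn s q.1 q.2)
        (f := fun z : ι → ℝ => (z i, z)) (by fun_prop))
  have hE : MeasurableSet
      {z : ι → ℝ | z i ∈ A ∧ (∀ l ∈ s, z i < z l) ∧ shiftOn s (z i) z ∘ σ ∈ B} :=
    (hA.preimage (measurable_pi_apply i)).inter
      ((measurableSet_forall_lt s (measurable_pi_apply i)).inter (hB.preimage hshift))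
  have slice : ∀ t, 0 < t → Measure.infinitePi (fun j => expMeasure (r j))
      {y | Function.update y i t ∈
        {z : ι → ℝ | z i ∈ A ∧ (∀ l ∈ s, z i < z l) ∧ shiftOn s (z i) z ∘ σ ∈ B}} =
      A.indicator (fun t => ENNReal.ofReal (Real.exp (-((∑ l ∈ s, r l) * t)))) t *
        Measure.infinitePi (fun k => expMeasure (r (σ k))) B := fun t ht => by
    simp only [Set.mem_ofPred_eq, Function.update_self]
    by_cases htA : t ∈ A
    · simpa only [htA, true_and, Set.indicator_of_mem] using
        infinitePi_expMeasure_setOf_update_race hr hi hσ hσi ht.le hB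
    · simp [htA]
  have hsum : 0 ≤ ∑ l ∈ s, r l := s.sum_nonneg fun l _ => (hr l).le
  rw [infinitePi_apply_eq_lintegral_symm _ i hE,
    lintegral_congr_ae ((ae_pos_expMeasure (r i)).mono slice),
    lintegral_mul_const _ (Measurable.indicator (by fun_prop) hA), lintegral_indicator hA,
    setLIntegral_exp_neg_mul_expMeasure (hr i).le (by linarith [hr i]) hA]

end ExponentialClocks

/-! ### Branching clocks -/

section Clocks

variable {b : ℕ → ℝ} {m i : ℕ} {x : ℕ × ℕ → ℝ}

/-- The law of independent exponential holding times: individual `i` waits `x (i, k)` between its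
`k`-th and its `(k + 1)`-st birth, and gives birth at rate `b i + k` meanwhile. -/
noncomputable def clockMeasure (b : ℕ → ℝ) : Measure (ℕ × ℕ → ℝ) :=
  Measure.infinitePi fun p => expMeasure (b p.1 + p.2)

lemma isProbabilityMeasure_clockMeasure (hb : ∀ i, 0 < b i) :
    IsProbabilityMeasure (clockMeasure b) := by
  have := fun p : ℕ × ℕ => isProbabilityMeasure_expMeasure (add_pos_of_pos_of_nonneg (hb p.1)
    (Nat.cast_nonneg p.2))
  unfold clockMeasure
  infer_instance

lemma ae_pos_clockMeasure (hb : ∀ i, 0 < b i) : ∀ᵐ x ∂clockMeasure b, ∀ p, 0 < x p := by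
  have := fun p : ℕ × ℕ => isProbabilityMeasure_expMeasure (add_pos_of_pos_of_nonneg (hb p.1)
    (Nat.cast_nonneg p.2))
  refine ae_all_iff.2 fun p => ?_
  have hp := ae_pos_expMeasure (b p.1 + p.2)
  rw [← Measure.infinitePi_map_eval (fun p : ℕ × ℕ => expMeasure (b p.1 + p.2)) p] at hp
  exact ae_of_ae_map (measurable_pi_apply p).aemeasurable hp

/-- The time until the first birth among the individuals `0, …, m - 1`. -/
noncomputable def firstRing (m : ℕ) (x : ℕ × ℕ → ℝ) : ℝ :=
  ⨅ i : Fin m, x (i, 0)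

/-- The clocks seen from the first birth among the individuals `0, …, m - 1` on: whoever gives
birth moves on to the next holding time, and the others of these individuals keep their residual
waiting times. -/
noncomputable def advance (m : ℕ) (x : ℕ × ℕ → ℝ) (p : ℕ × ℕ) : ℝ :=
  if p.1 < m then
    if x (p.1, 0) = firstRing m x then x (p.1, p.2 + 1)
    else if p.2 = 0 then x p - firstRing m x else x p
  else x p

/-- Individual `i` alone gives birth first among the individuals `0, …, m - 1`. -/
def IsFirst (m i : ℕ) (x : ℕ × ℕ → ℝ) : Prop :=
  ∀ j < m, j ≠ i → x (i, 0) < x (j, 0)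

lemma measurable_firstRing (m : ℕ) : Measurable (firstRing m) :=
  Measurable.iInf fun _ => measurable_pi_apply _

lemma measurable_advance (m : ℕ) : Measurable (advance m) :=
  measurable_pi_lambda _ fun p => by
    unfold advance
    have := measurable_firstRing m
    split_ifs
    · exact Measurable.ite (measurableSet_eq_fun (measurable_pi_apply _) this) (by fun_prop)
        (by fun_prop)
    · exact Measurable.ite (measurableSet_eq_fun (measurable_pi_apply _) this) (by fun_prop)
        (by fun_prop)
    · fun_prop

lemma measurableSet_isFirst (m i : ℕ) : MeasurableSet {x | IsFirst m i x} := by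
  simp only [IsFirst, Set.ofPred_forall]
  exact .iInter fun j => .iInter fun _ => .iInter fun _ =>
    measurableSet_lt (measurable_pi_apply _) (measurable_pi_apply _)

lemma firstRing_le (hi : i < m) (x : ℕ × ℕ → ℝ) : firstRing m x ≤ x (i, 0) :=
  ciInf_le (Set.finite_range _).bddBelow (⟨i, hi⟩ : Fin m)

lemma exists_eq_firstRing (hm : 0 < m) (x : ℕ × ℕ → ℝ) : ∃ i < m, x (i, 0) = firstRing m x :=
  have : Nonempty (Fin m) := ⟨⟨0, hm⟩⟩
  let ⟨i, hi⟩ := exists_eq_ciInf_of_finite (f := fun i : Fin m => x (i, 0))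
  ⟨i, i.2, hi⟩

lemma firstRing_pos (hm : 0 < m) (hx : ∀ p, 0 < x p) : 0 < firstRing m x :=
  let ⟨_, _, hi⟩ := exists_eq_firstRing hm x
  hi ▸ hx _

lemma advance_pos (hx : ∀ p, 0 < x p) (p : ℕ × ℕ) : 0 < advance m x p := by
  unfold advance
  split_ifs with hp hring hzero
  · exact hx _
  · obtain ⟨i, k⟩ := p
    obtain rfl : k = 0 := hzero
    exact sub_pos.2 ((firstRing_le hp x).lt_of_ne' hring)
  · exact hx _
  · exact hx _

lemma IsFirst.eq {j : ℕ} (hi : i < m) (hj : j < m) (hix : IsFirst m i x) (hjx : IsFirst m j x) :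
    i = j := by
  by_contra hne
  exact lt_asymm (hix j hj (Ne.symm hne)) (hjx i hi hne)

lemma IsFirst.firstRing_eq (hi : i < m) (hix : IsFirst m i x) : firstRing m x = x (i, 0) := by
  obtain ⟨j, hj, hjx⟩ := exists_eq_firstRing (Nat.zero_lt_of_lt hi) x
  rcases eq_or_ne j i with rfl | hne
  · exact hjx.symm
  · exact absurd (hix j hj hne) (hjx ▸ firstRing_le hi x).not_gt

/-- The holding times that are still to be read once individual `i` has given birth. -/
def dropFirst (i : ℕ) (p : ℕ × ℕ) : ℕ × ℕ :=
  (p.1, if p.1 = i then p.2 + 1 else p.2)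

lemma injective_dropFirst (i : ℕ) : Function.Injective (dropFirst i) := by
  rintro ⟨j, k⟩ ⟨j', k'⟩ h
  simp only [dropFirst, Prod.mk.injEq] at h
  obtain ⟨rfl, h⟩ := h
  split_ifs at h <;> simp_all

lemma dropFirst_ne (i : ℕ) (p : ℕ × ℕ) : dropFirst i p ≠ (i, 0) := by
  simp only [dropFirst, ne_eq, Prod.mk.injEq, not_and]
  intro hp
  simp [hp]

/-- The current clocks of the individuals `0, …, m - 1` other than `i`. -/
def rivals (m i : ℕ) : Finset (ℕ × ℕ) :=
  (Finset.range m).erase i ×ˢ {0}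

lemma IsFirst.advance_eq (hi : i < m) (hix : IsFirst m i x) :
    advance m x = shiftOn (rivals m i) (x (i, 0)) x ∘ dropFirst i := by
  ext ⟨j, k⟩
  have hring : j < m → (x (j, 0) = x (i, 0) ↔ j = i) := fun hj =>
    ⟨fun h => by_contra fun hne => (hix j hj hne).ne' h, fun h => h ▸ rfl⟩
  by_cases hj : j < m
  · rcases eq_or_ne j i with rfl | hne
    · simp [advance, hix.firstRing_eq hi, shiftOn, dropFirst, rivals, hj]
    · simp [advance, hix.firstRing_eq hi, shiftOn, dropFirst, rivals, hj, hring hj, hne,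
        eq_comm (a := k)]
  · have hne : j ≠ i := fun h => hj (h ▸ hi)
    simp [advance, shiftOn, dropFirst, rivals, hj, hne]

lemma isFirst_iff_rivals : IsFirst m i x ↔ ∀ p ∈ rivals m i, x (i, 0) < x p := by
  simp only [IsFirst, rivals, Finset.mem_product, Finset.mem_erase, Finset.mem_range,
    Finset.mem_singleton, Prod.forall, and_imp]
  exact ⟨fun h j k hne hj hk => hk ▸ h j hj hne, fun h j hj hne => h j 0 hne hj rfl⟩

/-- `b + Pi.single i 1` appears because the winner `i` moves on to its next holding time, while lack
of memory leaves the rates of all others unchanged. -/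
theorem clockMeasure_isFirst (hb : ∀ i, 0 < b i) (hi : i < m) {A : Set ℝ} (hA : MeasurableSet A)
    {B : Set (ℕ × ℕ → ℝ)} (hB : MeasurableSet B) :
    clockMeasure b {x | IsFirst m i x ∧ firstRing m x ∈ A ∧ advance m x ∈ B} =
      ENNReal.ofReal (b i / ∑ j ∈ Finset.range m, b j) *
        expMeasure (∑ j ∈ Finset.range m, b j) A * clockMeasure (b + Pi.single i 1) B := by
  have race := infinitePi_expMeasure_race (r := fun p : ℕ × ℕ => b p.1 + p.2)
    (fun p => add_pos_of_pos_of_nonneg (hb p.1) (Nat.cast_nonneg p.2)) (i := (i, 0))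
    (s := rivals m i) (by simp [rivals]) (injective_dropFirst i) (dropFirst_ne i) hA hB
  have rate_sum : b i + ((0 : ℕ) : ℝ) + ∑ p ∈ rivals m i, (b p.1 + p.2) =
      ∑ j ∈ Finset.range m, b j := by
    rw [rivals, Finset.sum_product]
    simp only [Finset.sum_singleton, Nat.cast_zero, add_zero]
    exact Finset.add_sum_erase _ _ (Finset.mem_range.2 hi)
  have rate_dropFirst : ∀ p, b (dropFirst i p).1 + ((dropFirst i p).2 : ℝ) =
      (b + Pi.single i 1 : ℕ → ℝ) p.1 + p.2 := fun p => by
    by_cases hp : p.1 = i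
    · simp [dropFirst, hp, add_comm, add_left_comm]
    · simp [dropFirst, hp]
  simp only [rate_sum, rate_dropFirst] at race
  rw [Nat.cast_zero, add_zero] at race
  unfold clockMeasure
  rw [← race]
  congr 1 with x
  simp only [Set.mem_ofPred_eq, ← isFirst_iff_rivals]
  constructor
  · rintro ⟨hfirst, h⟩
    rw [hfirst.firstRing_eq hi, hfirst.advance_eq hi] at h
    exact ⟨h.1, hfirst, h.2⟩
  · rintro ⟨hA, hfirst, hB⟩
    exact ⟨hfirst, hfirst.firstRing_eq hi ▸ hA, hfirst.advance_eq hi ▸ hB⟩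

lemma add_single_one_pos (hb : ∀ i, 0 < b i) (i j : ℕ) :
    0 < (b + Pi.single i 1 : ℕ → ℝ) j :=
  add_pos_of_pos_of_nonneg (hb j) ((Pi.single_nonneg (α := fun _ => ℝ)).2 zero_le_one j)

lemma sum_range_add_single_one (b : ℕ → ℝ) {n : ℕ} (hi : i < n) :
    ∑ j ∈ Finset.range n, (b + Pi.single i 1 : ℕ → ℝ) j = ∑ j ∈ Finset.range n, b j + 1 := by
  simp [Finset.sum_add_distrib, hi]

lemma clockMeasure_exists_isFirst (hb : ∀ i, 0 < b i) (hm : 0 < m) {A : Set ℝ}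
    (hA : MeasurableSet A) {B : Set (ℕ × ℕ → ℝ)} (hB : MeasurableSet B) {c : ENNReal}
    (hc : ∀ i < m, clockMeasure (b + Pi.single i 1) B = c) :
    clockMeasure b {x | (∃ i < m, IsFirst m i x) ∧ firstRing m x ∈ A ∧ advance m x ∈ B} =
      expMeasure (∑ i ∈ Finset.range m, b i) A * c := by
  have hsum : 0 < ∑ i ∈ Finset.range m, b i :=
    Finset.sum_pos (fun i _ => hb i) (Finset.nonempty_range_iff.2 hm.ne')
  have by_first : {x | (∃ i < m, IsFirst m i x) ∧ firstRing m x ∈ A ∧ advance m x ∈ B} =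
      ⋃ i ∈ Finset.range m, {x | IsFirst m i x ∧ firstRing m x ∈ A ∧ advance m x ∈ B} := by
    ext x
    simp only [Set.mem_ofPred_eq, Set.mem_iUnion, Finset.mem_range]
    tauto
  rw [by_first, measure_biUnion_finset]
  · have summand : ∀ i ∈ Finset.range m,
        clockMeasure b {x | IsFirst m i x ∧ firstRing m x ∈ A ∧ advance m x ∈ B} =
          ENNReal.ofReal (b i / ∑ j ∈ Finset.range m, b j) *
            (expMeasure (∑ j ∈ Finset.range m, b j) A * c) := fun i hi => by
      have hi := Finset.mem_range.1 hi
      rw [clockMeasure_isFirst hb hi hA hB, hc i hi, mul_assoc]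
    rw [Finset.sum_congr rfl summand, ← Finset.sum_mul,
      ← ENNReal.ofReal_sum_of_nonneg fun i _ => (div_pos (hb i) hsum).le, ← Finset.sum_div,
      div_self hsum.ne', ENNReal.ofReal_one, one_mul]
  · intro i hi j hj hne
    refine Set.disjoint_left.2 fun x hix hjx => hne ?_
    exact hix.1.eq (Finset.mem_range.1 hi) (Finset.mem_range.1 hj) hjx.1
  · exact fun i _ => (measurableSet_isFirst m i).inter
      ((hA.preimage (measurable_firstRing m)).inter (hB.preimage (measurable_advance m)))

lemma ae_exists_isFirst (hb : ∀ i, 0 < b i) (hm : 0 < m) :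
    ∀ᵐ x ∂clockMeasure b, ∃ i < m, IsFirst m i x := by
  have := isProbabilityMeasure_clockMeasure hb
  have hsum : 0 < ∑ i ∈ Finset.range m, b i :=
    Finset.sum_pos (fun i _ => hb i) (Finset.nonempty_range_iff.2 hm.ne')
  have := isProbabilityMeasure_expMeasure hsum
  have hc : ∀ i < m, clockMeasure (b + Pi.single i 1) Set.univ = 1 := fun i _ =>
    have := isProbabilityMeasure_clockMeasure (add_single_one_pos hb i)
    measure_univ
  have h := clockMeasure_exists_isFirst hb hm .univ .univ hc
  simp only [Set.mem_univ, and_true, measure_univ, mul_one] at h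
  have hmeas : MeasurableSet {x | ∃ i < m, IsFirst m i x} := by
    simp only [Set.ofPred_exists, Set.ofPred_and]
    exact .iUnion fun i => .inter (.const _) (measurableSet_isFirst m i)
  exact (mem_ae_iff_prob_eq_one hmeas).2 h

theorem clockMeasure_firstRing_advance (hb : ∀ i, 0 < b i) (hm : 0 < m) {A : Set ℝ}
    (hA : MeasurableSet A) {B : Set (ℕ × ℕ → ℝ)} (hB : MeasurableSet B) {c : ENNReal}
    (hc : ∀ i < m, clockMeasure (b + Pi.single i 1) B = c) :
    clockMeasure b {x | firstRing m x ∈ A ∧ advance m x ∈ B} =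
      expMeasure (∑ i ∈ Finset.range m, b i) A * c := by
  rw [← clockMeasure_exists_isFirst hb hm hA hB hc]
  exact measure_congr (eventuallyEq_set.2
    ((ae_exists_isFirst hb hm).mono fun _ hx => (and_iff_right hx).symm))

/-- The successive times between births, starting from the `m` individuals `0, …, m - 1` and with
the individuals `m, m + 1, …` to be born in this order. -/
noncomputable def ringGap : ℕ → (ℕ × ℕ → ℝ) → ℕ → ℝ
  | m, x, 0 => firstRing m x
  | m, x, n + 1 => ringGap (m + 1) (advance m x) n

lemma measurable_ringGap (m n : ℕ) : Measurable fun x => ringGap m x n := by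
  induction n generalizing m with
  | zero => exact measurable_firstRing m
  | succ n ih => exact (ih (m + 1)).comp (measurable_advance m)

lemma clockMeasure_ringGap_mem (hb : ∀ i, 0 < b i) (hm : 0 < m) (n : ℕ) {A : ℕ → Set ℝ}
    (hA : ∀ j, MeasurableSet (A j)) :
    clockMeasure b {x | ∀ j < n, ringGap m x j ∈ A j} =
      ∏ j ∈ Finset.range n, expMeasure (∑ i ∈ Finset.range (m + j), b i + j) (A j) := by
  induction n generalizing m b A with
  | zero =>
    have := isProbabilityMeasure_clockMeasure hb
    simp
  | succ n ih =>
    have split_first : {x | ∀ j < n + 1, ringGap m x j ∈ A j} =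
        {x | firstRing m x ∈ A 0 ∧
          advance m x ∈ {y | ∀ j < n, ringGap (m + 1) y j ∈ A (j + 1)}} := by
      ext x
      simp only [Set.mem_ofPred_eq, ringGap, Nat.forall_lt_succ_left]
    have hB : MeasurableSet {y | ∀ j < n, ringGap (m + 1) y j ∈ A (j + 1)} := by
      simp only [Set.ofPred_forall]
      exact .iInter fun j => .iInter fun _ => (hA (j + 1)).preimage (measurable_ringGap (m + 1) j)
    rw [split_first, clockMeasure_firstRing_advance hb hm (hA 0) hB fun i hi => by
      rw [ih (add_single_one_pos hb i) m.succ_pos fun j => hA (j + 1),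
        Finset.prod_congr rfl fun j _ => by
          rw [sum_range_add_single_one b (show i < m + 1 + j by omega)]],
      Finset.prod_range_succ', mul_comm]
    congr 1
    · refine Finset.prod_congr rfl fun j _ => ?_
      rw [add_right_comm m 1 j, add_assoc m j 1]
      push_cast
      ring_nf
    · simp

lemma sum_range_add_natCast_pos (hb : ∀ i, 0 < b i) (hm : 0 < m) (j : ℕ) :
    0 < ∑ i ∈ Finset.range (m + j), b i + j :=
  add_pos_of_pos_of_nonneg (Finset.sum_pos (fun i _ => hb i)
    (Finset.nonempty_range_iff.2 (by omega))) (Nat.cast_nonneg j)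

theorem map_ringGap_clockMeasure (hb : ∀ i, 0 < b i) (hm : 0 < m) :
    (clockMeasure b).map (ringGap m) =
      Measure.infinitePi fun j : ℕ => expMeasure (∑ i ∈ Finset.range (m + j), b i + j) := by
  have := fun j => isProbabilityMeasure_expMeasure (sum_range_add_natCast_pos hb hm j)
  have hmeas : Measurable (ringGap m) := measurable_pi_lambda _ (measurable_ringGap m)
  refine Measure.eq_infinitePi _ fun s T hT => ?_
  rw [Measure.map_apply hmeas (.pi s.countable_toSet fun i _ => hT i)]
  obtain ⟨n, hn⟩ := s.exists_nat_subset_range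
  have fill_univ : ringGap m ⁻¹' Set.pi (s : Set ℕ) T =
      {x | ∀ j < n, ringGap m x j ∈ if j ∈ s then T j else Set.univ} := by
    ext x
    simp only [Set.mem_preimage, Set.mem_pi, Finset.mem_coe, Set.mem_ofPred_eq]
    constructor
    · intro h j _
      split_ifs with hj
      · exact h j hj
      · trivial
    · intro h j hj
      simpa [hj] using h j (Finset.mem_range.1 (hn hj))
  rw [fill_univ, clockMeasure_ringGap_mem hb hm n fun j => by split_ifs <;> simp [hT j],
    ← Finset.prod_subset hn fun j _ hj => by rw [if_neg hj, measure_univ]]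
  exact Finset.prod_congr rfl fun j hj => by rw [if_pos hj]

end Clocks

/-! ### Branching times -/

section Advance

variable {m i : ℕ} {x : ℕ × ℕ → ℝ}

lemma advance_apply_of_le (hi : m ≤ i) (k : ℕ) : advance m x (i, k) = x (i, k) :=
  if_neg hi.not_gt

lemma firstRing_add_sum_advance_of_eq (hi : i < m) (hring : x (i, 0) = firstRing m x) (k : ℕ) :
    firstRing m x + ∑ l ∈ Finset.range k, advance m x (i, l) =
      ∑ l ∈ Finset.range (k + 1), x (i, l) := by
  simp only [advance, hi, hring, if_true]
  rw [Finset.sum_range_succ', hring, add_comm]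

lemma firstRing_add_sum_advance_of_ne (hi : i < m) (hring : x (i, 0) ≠ firstRing m x) (k : ℕ) :
    firstRing m x + ∑ l ∈ Finset.range (k + 1), advance m x (i, l) =
      ∑ l ∈ Finset.range (k + 1), x (i, l) := by
  simp only [advance, hi, hring, if_true, if_false, Finset.sum_range_succ', Nat.succ_ne_zero]
  ring

end Advance

/-- `S 0 = 0 ≤ S 1 ≤ S 2 ≤ …` are the times at which individuals are born, when there are the `m`
individuals `0, …, m - 1` at time `0`, individual `m + n` is born at time `S (n + 1)`, and every
individual `i` waits `x (i, k)` between its `k`-th and its `(k + 1)`-st birth. By truncated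
subtraction, `S (i + 1 - m)` is the time of birth of individual `i` also when `i < m`. -/
structure IsBranching (m : ℕ) (x : ℕ × ℕ → ℝ) (S : ℕ → ℝ) : Prop where
  zero : S 0 = 0
  succ : ∀ n, S (n + 1) = sInf {t | ∃ i < m + n, ∃ k,
    t = S (i + 1 - m) + ∑ l ∈ Finset.range (k + 1), x (i, l) ∧ S n < t}

namespace IsBranching

variable {m : ℕ} {x : ℕ × ℕ → ℝ} {S : ℕ → ℝ}

lemma birthTimes_nonempty (hx : ∀ p, 0 < x p) (hm : 0 < m) (n : ℕ) :
    {t | ∃ i < m + n, ∃ k,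
      t = S (i + 1 - m) + ∑ l ∈ Finset.range (k + 1), x (i, l) ∧ S n < t}.Nonempty := by
  refine ⟨_, m + n - 1, by omega, 0, rfl, ?_⟩
  rw [show m + n - 1 + 1 - m = n by omega, Finset.sum_range_one]
  exact lt_add_of_pos_right _ (hx _)

lemma bddBelow_birthTimes (n : ℕ) :
    BddBelow {t | ∃ i < m + n, ∃ k,
      t = S (i + 1 - m) + ∑ l ∈ Finset.range (k + 1), x (i, l) ∧ S n < t} :=
  ⟨S n, fun _ ⟨_, _, _, _, ht⟩ => ht.le⟩

lemma monotone (hS : IsBranching m x S) (hx : ∀ p, 0 < x p) (hm : 0 < m) : Monotone S :=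
  monotone_nat_of_le_succ fun n => by
    rw [hS.succ n]
    exact le_csInf (birthTimes_nonempty hx hm n) fun _ ⟨_, _, _, _, ht⟩ => ht.le

lemma one_eq (hS : IsBranching m x S) (hx : ∀ p, 0 < x p) (hm : 0 < m) :
    S 1 = firstRing m x := by
  rw [hS.succ 0]
  refine IsLeast.csInf_eq ⟨?_, ?_⟩
  · obtain ⟨i, hi, hix⟩ := exists_eq_firstRing hm x
    refine ⟨i, hi, 0, ?_, ?_⟩
    · rw [Nat.sub_eq_zero_of_le hi, hS.zero, Finset.sum_range_one, zero_add, hix]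
    · rw [hS.zero]
      exact firstRing_pos hm hx
  · rintro _ ⟨i, hi, k, rfl, -⟩
    rw [show i + 1 - m = 0 by omega, hS.zero, zero_add]
    exact (firstRing_le hi x).trans
      (Finset.single_le_sum (f := fun l => x (i, l)) (fun l _ => (hx _).le) (by simp))

lemma exists_eq_add_sum_advance_iff (hS : IsBranching m x S) (hx : ∀ p, 0 < x p) (hm : 0 < m)
    (i : ℕ) {t : ℝ} (ht : S 1 < t) :
    (∃ k, t = S (i + 1 - (m + 1) + 1) + ∑ l ∈ Finset.range (k + 1), advance m x (i, l)) ↔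
      ∃ k, t = S (i + 1 - m) + ∑ l ∈ Finset.range (k + 1), x (i, l) := by
  rcases le_or_gt m i with hi | hi
  · simp only [advance_apply_of_le hi, show i + 1 - (m + 1) + 1 = i + 1 - m by omega]
  have hone := hS.one_eq hx hm
  rw [Nat.sub_eq_zero_of_le hi, Nat.sub_eq_zero_of_le (by omega), zero_add, hS.zero, hone]
  simp only [zero_add]
  by_cases hring : x (i, 0) = firstRing m x
  · simp only [firstRing_add_sum_advance_of_eq hi hring]
    refine ⟨fun ⟨k, hk⟩ => ⟨k + 1, hk⟩, ?_⟩
    rintro ⟨_ | k, hk⟩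
    · rw [Finset.sum_range_one, hring, ← hone] at hk
      exact absurd hk ht.ne'
    · exact ⟨k, hk⟩
  · simp only [firstRing_add_sum_advance_of_ne hi hring]

theorem shift (hS : IsBranching m x S) (hx : ∀ p, 0 < x p) (hm : 0 < m) :
    IsBranching (m + 1) (advance m x) fun n => S (n + 1) - S 1 := by
  refine ⟨sub_self _, fun n => ?_⟩
  have translate := (OrderIso.subRight (S 1)).map_csInf'
    (birthTimes_nonempty (S := S) hx hm (n + 1)) (bddBelow_birthTimes (n + 1))
  rw [← hS.succ (n + 1), OrderIso.image_eq_preimage_symm] at translate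
  refine translate.trans (congrArg sInf ?_)
  ext t
  have birth_iff : ∀ i, (∃ k, t = S (i + 1 - (m + 1) + 1) - S 1 +
      ∑ l ∈ Finset.range (k + 1), advance m x (i, l) ∧ S (n + 1) - S 1 < t) ↔
      ∃ k, t + S 1 = S (i + 1 - m) + ∑ l ∈ Finset.range (k + 1), x (i, l) ∧
        S (n + 1) < t + S 1 := fun i => by
    rw [exists_and_right, exists_and_right, sub_lt_iff_lt_add]
    refine and_congr_left fun ht => ?_
    rw [← hS.exists_eq_add_sum_advance_iff hx hm i
      ((hS.monotone hx hm (Nat.le_add_left 1 n)).trans_lt ht)]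
    refine exists_congr fun k => ?_
    rw [sub_add_eq_add_sub, eq_sub_iff_add_eq]
  simp only [Set.mem_preimage, Set.mem_ofPred_eq, birth_iff, add_right_comm m 1 n, add_assoc m n 1]
  rfl

theorem eq_sum_ringGap (hS : IsBranching m x S) (hx : ∀ p, 0 < x p) (hm : 0 < m) (n : ℕ) :
    S n = ∑ j ∈ Finset.range n, ringGap m x j := by
  induction n generalizing m x S with
  | zero => rw [hS.zero, Finset.sum_range_zero]
  | succ n ih =>
    rw [Finset.sum_range_succ', ringGap, ← hS.one_eq hx hm]
    exact sub_eq_iff_eq_add.1 (ih (hS.shift hx hm) (advance_pos hx) m.succ_pos)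

end IsBranching

/-! ### Holding times of birth processes -/

/-- The time a path spends between its `k`-th and its `(k + 1)`-st jump. -/
noncomputable def holdingTime (x : ℝ≥0 → ℕ) (k : ℕ) : ℝ :=
  jumpTime x (k + 1) - jumpTime x k

lemma sum_range_holdingTime (x : ℝ≥0 → ℕ) (k : ℕ) :
    ∑ l ∈ Finset.range k, holdingTime x l = jumpTime x k := by
  simp only [holdingTime]
  rw [Finset.sum_range_sub fun l => (jumpTime x l : ℝ), jumpTime, NNReal.coe_zero, sub_zero]

/-- The first time at which a path is at `a` or above. The infimum over a countable dense set makes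
this a measurable function of the path, which `jumpTime` is not. -/
noncomputable def hittingTime (a : ℕ) (x : ℝ≥0 → ℕ) : ENNReal :=
  ⨅ n, if a ≤ x (TopologicalSpace.denseSeq ℝ≥0 n) then
    (TopologicalSpace.denseSeq ℝ≥0 n : ENNReal) else ⊤

/-- The time a path takes from `a + k` to `a + k + 1`: a measurable substitute for `holdingTime`,
for the paths of a birth process started at `a`. -/
noncomputable def passageTime (a : ℕ) (x : ℝ≥0 → ℕ) (k : ℕ) : ℝ :=
  (hittingTime (a + (k + 1)) x).toReal - (hittingTime (a + k) x).toReal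

lemma measurable_hittingTime (a : ℕ) : Measurable (hittingTime a) :=
  .iInf fun _ => .ite (measurableSet_le measurable_const (measurable_pi_apply _))
    measurable_const measurable_const

lemma measurable_passageTime (a : ℕ) : Measurable (passageTime a) :=
  measurable_pi_lambda _ fun _ =>
    (measurable_hittingTime _).ennreal_toReal.sub (measurable_hittingTime _).ennreal_toReal

section Path

variable {x : ℝ≥0 → ℕ} {a k : ℕ} {t : ℝ≥0}

lemma eq_jumpTime_of_mem_Ico (ht : t ∈ Set.Ico (jumpTime x k) (jumpTime x (k + 1))) :
    x t = x (jumpTime x k) := by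
  by_contra hne
  have h := ht.2
  rw [jumpTime] at h
  exact notMem_of_lt_csInf h (OrderBot.bddBelow _) ⟨ht.1, hne⟩

lemma lt_of_lt_jumpTime (hchain : ∀ k, x (jumpTime x k) = a + k) (ht : t < jumpTime x k) :
    x t < a + k := by
  induction k with
  | zero => exact absurd ht not_lt_zero
  | succ k ih =>
    rcases lt_or_ge t (jumpTime x k) with h | h
    · exact (ih h).trans (Nat.lt_succ_self _)
    · rw [eq_jumpTime_of_mem_Ico ⟨h, ht⟩, hchain]
      exact Nat.lt_succ_self _

lemma hittingTime_le (hrc : ContinuousWithinAt x (Set.Ici t) t) : hittingTime (x t) x ≤ t := by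
  refine ENNReal.le_of_forall_pos_le_add fun ε hε _ => ?_
  have eventually_eq : ∀ᶠ s in 𝓝[≥] t, x s = x t := by
    rw [ContinuousWithinAt, nhds_discrete, tendsto_pure] at hrc
    exact hrc
  obtain ⟨u, hu, hsub⟩ := mem_nhdsGE_iff_exists_Ico_subset.1 eventually_eq
  obtain ⟨n, hn⟩ := (TopologicalSpace.denseRange_denseSeq ℝ≥0).exists_mem_open isOpen_Ioo
    (Set.nonempty_Ioo.2 (lt_min hu (lt_add_of_pos_right t hε)))
  have hx : x (TopologicalSpace.denseSeq ℝ≥0 n) = x t :=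
    hsub ⟨hn.1.le, hn.2.trans_le (min_le_left _ _)⟩
  refine (iInf_le _ n).trans ?_
  rw [if_pos hx.ge]
  exact_mod_cast (hn.2.trans_le (min_le_right _ _)).le

lemma hittingTime_eq_jumpTime (hrc : ∀ t, ContinuousWithinAt x (Set.Ici t) t)
    (hchain : ∀ k, x (jumpTime x k) = a + k) (k : ℕ) : hittingTime (a + k) x = jumpTime x k := by
  refine le_antisymm (hchain k ▸ hittingTime_le (hrc _)) (le_iInf fun n => ?_)
  split_ifs with h
  · exact ENNReal.coe_le_coe.2 (not_lt.1 fun hlt => (lt_of_lt_jumpTime hchain hlt).not_ge h)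
  · exact le_top

lemma passageTime_eq_holdingTime (hrc : ∀ t, ContinuousWithinAt x (Set.Ici t) t)
    (hchain : ∀ k, x (jumpTime x k) = a + k) (k : ℕ) : passageTime a x k = holdingTime x k := by
  rw [passageTime, hittingTime_eq_jumpTime hrc hchain, hittingTime_eq_jumpTime hrc hchain]
  rfl

end Path

section BirthProcess

variable {Ω : Type*} [MeasurableSpace Ω] {P : Measure Ω}

lemma IsBirthProcess.ae_passageTime_eq {X : ℝ≥0 → Ω → ℕ} {a : ℕ} {q : ℕ → ℝ}
    (hX : IsBirthProcess P X a q) :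
    ∀ᵐ ω ∂P, ∀ k, passageTime a (fun t => X t ω) k = holdingTime (fun t => X t ω) k := by
  filter_upwards [hX.rightContinuous, hX.jumpChain] with ω hrc hchain
  exact passageTime_eq_holdingTime hrc hchain

theorem hasLaw_holdingTime {ι : Type*} [Countable ι] {X : ι → ℝ≥0 → Ω → ℕ} {a : ι → ℕ}
    {q : ι → ℕ → ℝ} (hX : ∀ i, IsBirthProcess P (X i) (a i) (q i))
    (hindep : iIndepFun (fun i ω t => X i t ω) P) :
    HasLaw (fun ω (p : ι × ℕ) => holdingTime (fun t => X p.1 t ω) p.2)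
      (Measure.infinitePi fun p : ι × ℕ => expMeasure (q p.1 (a p.1 + p.2))) P := by
  let T : ι → ℕ → Ω → ℝ := fun i k ω => passageTime (a i) (fun t => X i t ω) k
  have hmeas : ∀ i k, Measurable (T i k) := fun i =>
    measurable_pi_iff.1 ((measurable_passageTime (a i)).comp
      (measurable_pi_lambda _ (hX i).measurable))
  have passage_eq : ∀ i k, T i k =ᵐ[P] fun ω => holdingTime (fun t => X i t ω) k := fun i k =>
    (hX i).ae_passageTime_eq.mono fun ω h => h k
  have indep_paths : iIndepFun (fun i ω k => T i k ω) P :=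
    hindep.comp (fun i => passageTime (a i)) fun i => measurable_passageTime (a i)
  have indep_path : ∀ i, iIndepFun (T i) P := fun i =>
    (hX i).holding_indep.congr fun k => (passage_eq i k).symm
  have law : ∀ p : ι × ℕ, HasLaw (T p.1 p.2) (expMeasure (q p.1 (a p.1 + p.2))) P := fun p =>
    ((hX p.1).holding_law p.2).congr (passage_eq p.1 p.2)
  have law_all := (iIndepFun_uncurry' hmeas indep_paths indep_path).hasLaw_infinitePi law
    (measurable_pi_lambda _ fun p : ι × ℕ => hmeas p.1 p.2).aemeasurable
  refine HasLaw.congr law_all ?_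
  filter_upwards [ae_all_iff.2 fun i => (hX i).ae_passageTime_eq] with ω hω
  ext p
  exact (hω p.1 p.2).symm

lemma hasLaw_holdingTime_of_isBIProcess {X : ℕ → ℝ≥0 → Ω → ℕ} {a : ℕ → ℕ} {δ : ℝ}
    (hX : ∀ i, IsBIProcess P (X i) (a i) δ) (hindep : iIndepFun (fun i ω t => X i t ω) P) :
    HasLaw (fun ω (p : ℕ × ℕ) => holdingTime (fun t => X p.1 t ω) p.2)
      (clockMeasure fun i => a i + δ) P := by
  have h := hasLaw_holdingTime hX hindep
  simp only [Nat.cast_add, add_right_comm] at h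
  exact h

end BirthProcess

/-! ### Products of independent random variables of mean one -/

section ProductMartingale

variable {Ω : Type*} [MeasurableSpace Ω] {P : Measure Ω} [IsProbabilityMeasure P] {Z : ℕ → Ω → ℝ}

lemma integrable_prod_range_of_iIndepFun (hmeas : ∀ n, Measurable (Z n)) (hindep : iIndepFun Z P)
    (hint : ∀ n, Integrable (Z n) P) (n : ℕ) : Integrable (∏ j ∈ Finset.range n, Z j) P := by
  induction n with
  | zero =>
    rw [Finset.prod_range_zero]
    exact integrable_const (1 : ℝ)
  | succ n ih =>
    rw [Finset.prod_range_succ]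
    exact (hindep.indepFun_prod_range_succ hmeas n).integrable_mul ih (hint n)

theorem martingale_prod_range_of_iIndepFun (hmeas : ∀ n, Measurable (Z n))
    (hindep : iIndepFun Z P) (hint : ∀ n, Integrable (Z n) P) (hmean : ∀ n, P[Z n] = 1) :
    Martingale (fun n => ∏ j ∈ Finset.range (n + 1), Z j)
      (Filtration.natural Z fun n => (hmeas n).stronglyMeasurable) P := by
  let ℱ := Filtration.natural Z fun n => (hmeas n).stronglyMeasurable
  have adapted : StronglyAdapted ℱ fun n => ∏ j ∈ Finset.range (n + 1), Z j := fun n =>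
    Finset.stronglyMeasurable_prod _ fun j hj =>
      (Filtration.stronglyAdapted_natural (fun n => (hmeas n).stronglyMeasurable) j).mono
        (ℱ.mono (Nat.lt_succ_iff.1 (Finset.mem_range.1 hj)))
  have integrable_prod := integrable_prod_range_of_iIndepFun hmeas hindep hint
  refine martingale_nat adapted (fun n => integrable_prod _) fun n => ?_
  have prod_succ := Finset.prod_range_succ Z (n + 1)
  have pull_out := condExp_mul_of_stronglyMeasurable_left (μ := P) (adapted n)
    (prod_succ ▸ integrable_prod (n + 2)) (hint (n + 1))
  have condExp_factor : P[Z (n + 1) | ℱ n] =ᵐ[P] fun _ => P[Z (n + 1)] :=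
    condExp_indep_eq (hmeas (n + 1)).comap_le (ℱ.le n)
      (comap_measurable (Z (n + 1))).stronglyMeasurable
      (hindep.indep_comap_natural_of_lt _ (Nat.lt_succ_self n))
  rw [prod_succ]
  filter_upwards [pull_out, condExp_factor] with ω hpull hfactor
  rw [hpull, Pi.mul_apply, hfactor, hmean, mul_one]

theorem ae_exists_tendsto_prod_range (hmeas : ∀ n, Measurable (Z n)) (hindep : iIndepFun Z P)
    (hnonneg : ∀ n, 0 ≤ Z n) (hint : ∀ n, Integrable (Z n) P) (hmean : ∀ n, P[Z n] = 1) :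
    ∀ᵐ ω ∂P, ∃ l, Tendsto (fun n => ∏ j ∈ Finset.range n, Z j ω) atTop (𝓝 l) := by
  have martingale := martingale_prod_range_of_iIndepFun hmeas hindep hint hmean
  have mean_prod : ∀ n, P[∏ j ∈ Finset.range (n + 1), Z j] = 1 := fun n => by
    have h := martingale.setIntegral_eq n.zero_le MeasurableSet.univ
    rw [setIntegral_univ, setIntegral_univ, zero_add, Finset.prod_range_one, hmean] at h
    exact h.symm
  have bounded : ∀ n, eLpNorm (∏ j ∈ Finset.range (n + 1), Z j) 1 P ≤ (1 : ℝ≥0) := fun n => by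
    have prod_nonneg : 0 ≤ ∏ j ∈ Finset.range (n + 1), Z j :=
      Finset.prod_nonneg fun j _ => hnonneg j
    rw [eLpNorm_one_eq_lintegral_enorm,
      lintegral_congr fun ω => Real.enorm_of_nonneg (prod_nonneg ω),
      ← ofReal_integral_eq_lintegral_ofReal (martingale.integrable n)
        (Eventually.of_forall prod_nonneg), mean_prod, ENNReal.ofReal_one, ENNReal.coe_one]
  filter_upwards [martingale.submartingale.exists_ae_tendsto_of_bdd bounded] with ω ⟨l, hl⟩
  refine ⟨l, (tendsto_add_atTop_iff_nat 1).1 ?_⟩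
  simpa only [Finset.prod_apply] using hl

end ProductMartingale

/-! ### The limit of a linear birth process -/

lemma tendsto_natCast_add_div_natCast_add (a b : ℝ) :
    Tendsto (fun n : ℕ => ((n : ℝ) + a) / (n + b)) atTop (𝓝 1) := by
  have atTop_add := tendsto_atTop_add_const_right _ b (tendsto_natCast_atTop_atTop (R := ℝ))
  have h : Tendsto (fun n : ℕ => 1 + (a - b) / ((n : ℝ) + b)) atTop (𝓝 (1 + 0)) :=
    tendsto_const_nhds.add (atTop_add.const_div_atTop _)
  rw [add_zero] at h
  refine h.congr' ?_
  filter_upwards [atTop_add.eventually_gt_atTop 0] with n hn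
  field_simp
  ring

lemma prod_range_add_one_div {s : ℝ} (hs : 0 < s) (n : ℕ) :
    ∏ j ∈ Finset.range n, (s + j + 1) / (s + j) = (s + n) / s := by
  refine Finset.prod_range_induction _ (fun j : ℕ => (s + j) / s) (by simp [hs.ne']) n fun j _ => ?_
  push_cast
  field_simp
  ring

lemma gammaSeq_add_div_gammaSeq {s : ℂ} (z : ℂ) {n : ℕ} (hn : n ≠ 0) :
    Complex.GammaSeq (s + z) n / Complex.GammaSeq s n =
      n ^ z * ∏ j ∈ Finset.range (n + 1), (s + j) / (s + z + j) := by
  have hn' : (n : ℂ) ≠ 0 := Nat.cast_ne_zero.2 hn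
  have cpow_ne_zero : (n : ℂ) ^ s ≠ 0 := by simp [Complex.cpow_eq_zero_iff, hn']
  have factorial_ne_zero : (n.factorial : ℂ) ≠ 0 := Nat.cast_ne_zero.2 n.factorial_ne_zero
  rw [Finset.prod_div_distrib, Complex.GammaSeq, Complex.GammaSeq, Complex.cpow_add _ _ hn']
  field_simp

section LinearBirth

variable {Ω : Type*} [MeasurableSpace Ω] {P : Measure Ω} {D : ℕ → Ω → ℝ} {c s : ℝ}

theorem ae_exists_tendsto_div_exp_sum (hc : 0 < c) (hs : 0 < s) (hmeas : ∀ j, Measurable (D j))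
    (hindep : iIndepFun D P) (hlaw : ∀ j : ℕ, HasLaw (D j) (expMeasure (c * (s + j))) P) :
    ∀ᵐ ω ∂P, ∃ l, Tendsto
      (fun n : ℕ => n / Real.exp (c * ∑ j ∈ Finset.range n, D j ω)) atTop (𝓝 l) := by
  have := hindep.isProbabilityMeasure
  let Z : ℕ → Ω → ℝ := fun j ω => (s + j + 1) / (s + j) * Real.exp (-c * D j ω)
  have hmean : ∀ j, P[Z j] = 1 := fun j => by
    have rate_pos : 0 < c * (s + j) := by positivity
    rw [integral_const_mul, ← integral_map (f := fun x => Real.exp (-c * x)) (hlaw j).aemeasurable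
      (by fun_prop), (hlaw j).map_eq, integral_exp_neg_mul_expMeasure rate_pos (by linarith)]
    field_simp
  have hint : ∀ j, Integrable (Z j) P := fun j =>
    Integrable.of_integral_ne_zero ((hmean j).trans_ne one_ne_zero)
  have hnonneg : ∀ j, 0 ≤ Z j := fun j ω => by positivity
  have indep : iIndepFun Z P :=
    hindep.comp (fun (j : ℕ) x => (s + j + 1) / (s + j) * Real.exp (-c * x)) fun j => by fun_prop
  filter_upwards [ae_exists_tendsto_prod_range (fun j => by fun_prop) indep hnonneg hint hmean]
    with ω ⟨l, hl⟩
  refine ⟨s * l * 1,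
    ((hl.const_mul s).mul (tendsto_natCast_add_div_natCast_add 0 s)).congr fun n => ?_⟩
  rw [Finset.prod_mul_distrib, prod_range_add_one_div hs, ← Real.exp_sum, ← Finset.mul_sum,
    neg_mul, Real.exp_neg, add_comm (n : ℝ) s]
  field_simp
  ring

lemma charFun_map_log_sub_sum (hc : 0 < c) (hs : 0 < s) (hindep : iIndepFun D P)
    (hlaw : ∀ j : ℕ, HasLaw (D j) (expMeasure (c * (s + j))) P) {n : ℕ} (hn : n ≠ 0) (t : ℝ) :
    charFun (P.map fun ω => Real.log n - c * ∑ j ∈ Finset.range (n + 1), D j ω) t =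
      Complex.GammaSeq (s + t * Complex.I) n / Complex.GammaSeq s n := by
  have hmeas : ∀ j, AEMeasurable (D j) P := fun j => (hlaw j).aemeasurable
  have sum_meas : AEMeasurable (fun ω => ∑ j ∈ Finset.range (n + 1), D j ω) P :=
    Finset.aemeasurable_fun_sum _ fun j _ => hmeas j
  have charFun_gap : ∀ j : ℕ,
      charFun (P.map (D j)) (-c * t) = (s + j) / (s + t * Complex.I + j) := fun j => by
    rw [(hlaw j).map_eq, charFun_expMeasure (by positivity),
      ← mul_div_mul_left ((s : ℂ) + j) _ (Complex.ofReal_ne_zero.2 hc.ne')]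
    push_cast
    ring_nf
  have map_eq : P.map (fun ω => Real.log n - c * ∑ j ∈ Finset.range (n + 1), D j ω) =
      (P.map fun ω => -c * ∑ j ∈ Finset.range (n + 1), D j ω).map (· + Real.log n) := by
    rw [AEMeasurable.map_map_of_aemeasurable (by fun_prop) (sum_meas.const_mul _)]
    congr 1 with ω
    simp only [Function.comp_apply]
    ring
  rw [map_eq, charFun_map_add_const, charFun_map_mul_comp sum_meas,
    (hindep.restrict _).charFun_map_fun_finsetSum_eq_prod fun j _ => hmeas j, Finset.prod_apply,
    Finset.prod_congr rfl fun j _ => charFun_gap j, gammaSeq_add_div_gammaSeq _ hn, mul_comm,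
    Complex.cpow_def_of_ne_zero (Nat.cast_ne_zero.2 hn), ← Complex.natCast_log]
  congr 2
  simp only [conj_trivial, RCLike.inner_apply]
  push_cast
  ring

lemma tendsto_charFun_map_log_sub_sum (hc : 0 < c) (hs : 0 < s) (hindep : iIndepFun D P)
    (hlaw : ∀ j : ℕ, HasLaw (D j) (expMeasure (c * (s + j))) P) (t : ℝ) :
    Tendsto (fun n : ℕ => charFun
      (P.map fun ω => Real.log n - c * ∑ j ∈ Finset.range (n + 1), D j ω) t) atTop
      (𝓝 (charFun ((gammaMeasure s 1).map Real.log) t)) := by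
  rw [charFun_map_log_gammaMeasure hs]
  refine ((Complex.GammaSeq_tendsto_Gamma _).div (Complex.GammaSeq_tendsto_Gamma _)
    (Complex.Gamma_ne_zero_of_re_pos (by simpa using hs))).congr' ?_
  filter_upwards [eventually_ne_atTop 0] with n hn
  exact (charFun_map_log_sub_sum hc hs hindep hlaw hn t).symm

theorem exists_hasLaw_gammaMeasure_tendsto_div_exp_sum (hc : 0 < c) (hs : 0 < s)
    (hmeas : ∀ j, Measurable (D j)) (hindep : iIndepFun D P)
    (hlaw : ∀ j : ℕ, HasLaw (D j) (expMeasure (c * (s + j))) P) :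
    ∃ W : Ω → ℝ, HasLaw W (gammaMeasure s 1) P ∧ ∀ᵐ ω ∂P, Tendsto
      (fun n : ℕ => n / Real.exp (c * ∑ j ∈ Finset.range n, D j ω)) atTop (𝓝 (W ω)) := by
  have := hindep.isProbabilityMeasure
  have := isProbabilityMeasure_gammaMeasure hs one_pos
  obtain ⟨W, hW, hlim⟩ := measurable_limit_of_tendsto_metrizable_ae
    (fun n => Measurable.aemeasurable (by fun_prop))
    (ae_exists_tendsto_div_exp_sum hc hs hmeas hindep hlaw)
  refine ⟨W, ⟨hW.aemeasurable, ?_⟩, hlim⟩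
  let L : ℕ → Ω → ℝ := fun n ω => Real.log n - c * ∑ j ∈ Finset.range (n + 1), D j ω
  have L_meas : ∀ n, AEMeasurable (L n) P := fun n => Measurable.aemeasurable (by fun_prop)
  have log_limit : TendstoInDistribution L atTop Real.log (fun _ => P) (gammaMeasure s 1) :=
    ⟨L_meas, Real.measurable_log.aemeasurable, ProbabilityMeasure.tendsto_of_tendsto_charFun
      (tendsto_charFun_map_log_sub_sum hc hs hindep hlaw)⟩
  have exp_limit : TendstoInDistribution (fun n => Real.exp ∘ L n) atTop W (fun _ => P) P := by
    refine tendstoInDistribution_of_ae_tendsto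
      (fun n => Real.measurable_exp.comp_aemeasurable (L_meas n)) hW.aemeasurable ?_
    filter_upwards [hlim] with ω hω
    have h := ((tendsto_add_atTop_iff_nat 1).2 hω).mul (tendsto_natCast_add_div_natCast_add 0 1)
    rw [mul_one] at h
    refine h.congr' ?_
    filter_upwards [eventually_gt_atTop 0] with n hn
    rw [Function.comp_apply, Real.exp_sub, Real.exp_log (Nat.cast_pos.2 hn)]
    push_cast
    field_simp
    ring
  rw [tendstoInDistribution_unique _ exp_limit (log_limit.continuous_comp Real.continuous_exp),
    ← Measure.map_map Real.measurable_exp Real.measurable_log,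
    map_exp_map_log_gammaMeasure]

end LinearBirth

/-! ### Models A and B -/

section Clocks

variable {b : ℕ → ℝ} {m : ℕ}

lemma hasLaw_ringGap (hb : ∀ i, 0 < b i) (hm : 0 < m) (j : ℕ) :
    HasLaw (fun x => ringGap m x j) (expMeasure (∑ i ∈ Finset.range (m + j), b i + j))
      (clockMeasure b) := by
  have := fun j => isProbabilityMeasure_expMeasure (sum_range_add_natCast_pos hb hm j)
  have hlaw : HasLaw (ringGap m) (Measure.infinitePi fun j : ℕ =>
      expMeasure (∑ i ∈ Finset.range (m + j), b i + j)) (clockMeasure b) :=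
    ⟨(measurable_pi_lambda _ (measurable_ringGap m)).aemeasurable, map_ringGap_clockMeasure hb hm⟩
  exact (measurePreserving_eval_infinitePi _ j).hasLaw.comp hlaw

lemma iIndepFun_ringGap (hb : ∀ i, 0 < b i) (hm : 0 < m) :
    iIndepFun (fun j x => ringGap m x j) (clockMeasure b) := by
  have := isProbabilityMeasure_clockMeasure hb
  rw [iIndepFun_iff_map_fun_eq_infinitePi_map (measurable_ringGap m)]
  simp only [(hasLaw_ringGap hb hm _).map_eq]
  exact map_ringGap_clockMeasure hb hm

theorem exists_hasLaw_gammaMeasure_tendsto_of_isBranching {Ω : Type*} [MeasurableSpace Ω]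
    {P : Measure Ω} (hb : ∀ i, 0 < b i) (hm : 0 < m) {c s : ℝ} (hc : 0 < c) (hs : 0 < s)
    (hrate : ∀ j : ℕ, ∑ i ∈ Finset.range (m + j), b i + j = c * (s + j))
    {E : Ω → ℕ × ℕ → ℝ} (hE : HasLaw E (clockMeasure b) P) {T : Ω → ℕ → ℝ}
    (hT : ∀ ω, IsBranching m (E ω) fun n => T ω (n + 1)) :
    ∃ W : Ω → ℝ, HasLaw W (gammaMeasure s 1) P ∧
      ∀ᵐ ω ∂P, Tendsto (fun n : ℕ => (n : ℝ) / Real.exp (c * T ω n)) atTop (𝓝 (W ω)) := by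
  obtain ⟨W, hW, hlim⟩ := exists_hasLaw_gammaMeasure_tendsto_div_exp_sum hc hs
    (measurable_ringGap m) (iIndepFun_ringGap hb hm) fun j => hrate j ▸ hasLaw_ringGap hb hm j
  have hpos := ae_pos_clockMeasure hb
  rw [← hE.map_eq] at hlim hpos
  refine ⟨W ∘ E, hW.comp hE, ?_⟩
  filter_upwards [ae_of_ae_map hE.aemeasurable hlim, ae_of_ae_map hE.aemeasurable hpos]
    with ω hω hpos
  refine (tendsto_add_atTop_iff_nat 1).1 ?_
  have h := hω.mul (tendsto_natCast_add_div_natCast_add 1 0)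
  rw [mul_one] at h
  refine h.congr' ?_
  filter_upwards [eventually_ne_atTop 0] with n hn
  rw [(hT ω).eq_sum_ringGap hpos hm n]
  push_cast
  field_simp
  ring

end Clocks

section Models

variable (x : ℕ+ → ℝ≥0 → ℕ)

lemma isBranching_branchTimeA :
    IsBranching 1 (fun p => holdingTime (x p.1.succPNat) p.2) fun n => branchTimeA x (n + 1) := by
  refine ⟨by rw [branchTimeA], fun n => ?_⟩
  rw [branchTimeA]
  congr 1 with t
  simp only [Set.mem_ofPred_eq, sum_range_holdingTime, add_tsub_cancel_right]
  constructor
  · rintro ⟨i, hi, k, hk, rfl, ht⟩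
    have := i.natPred_add_one
    refine ⟨i.natPred, by omega, k - 1, ?_, ht⟩
    rw [PNat.natPred_add_one, PNat.succPNat_natPred, Nat.sub_add_cancel hk]
  · rintro ⟨i, hi, k, rfl, ht⟩
    exact ⟨i.succPNat, by rw [Nat.succPNat_coe]; omega, k + 1, Nat.le_add_left 1 k, rfl, ht⟩

lemma isBranching_branchTimeB :
    IsBranching 2 (fun p => holdingTime (x p.1.succPNat) p.2) fun n => branchTimeB x (n + 1) := by
  have birth_eq : ∀ i, branchTimeB x (i + 1 - 2 + 1) = branchTimeB x i := by
    rintro (_ | i)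
    · change branchTimeB x 1 = branchTimeB x 0
      rw [branchTimeB, branchTimeB]
    · rfl
  refine ⟨by rw [branchTimeB], fun n => ?_⟩
  rw [branchTimeB]
  congr 1 with t
  simp only [Set.mem_ofPred_eq, sum_range_holdingTime, birth_eq]
  constructor
  · rintro ⟨i, hi, k, hk, rfl, ht⟩
    have := i.natPred_add_one
    refine ⟨i.natPred, by omega, k - 1, ?_, ht⟩
    rw [PNat.succPNat_natPred, Nat.sub_add_cancel hk]
    rfl
  · rintro ⟨i, hi, k, rfl, ht⟩
    exact ⟨i.succPNat, by rw [Nat.succPNat_coe]; omega, k + 1, Nat.le_add_left 1 k, rfl, ht⟩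

end Models

/-- The initial states of the birth processes of both models. Their index starts at `0` here. -/
def initialState : ℕ → ℕ
  | 0 => 2
  | _ + 1 => 1

lemma initialState_add_pos {δ : ℝ} (hδ : -1 < δ) (i : ℕ) : 0 < initialState i + δ := by
  cases i <;> simp only [initialState] <;> push_cast <;> linarith

lemma sum_range_initialState_add (δ : ℝ) (n : ℕ) :
    ∑ i ∈ Finset.range (n + 1), (initialState i + δ) = 2 + δ + n * (1 + δ) := by
  simp only [Finset.sum_range_succ', initialState, Finset.sum_const, Finset.card_range,
    nsmul_eq_mul]
  push_cast
  ring

end BranchingTimes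

theorem mainTheorem6 {Ω : Type*} [MeasurableSpace Ω] (P : Measure Ω) [IsProbabilityMeasure P]
    (δ : ℝ) (hδ : -1 < δ) (BI : ℕ+ → ℝ≥0 → Ω → ℕ)
    (hBI_one : BranchingTimes.IsBIProcess P (BI 1) 2 δ)
    (hBI : ∀ i : ℕ+, 2 ≤ i → BranchingTimes.IsBIProcess P (BI i) 1 δ)
    (hindep : iIndepFun (fun (i : ℕ+) (ω : Ω) (t : ℝ≥0) => BI i t ω) P) :
    (∃ W_A : Ω → ℝ, HasLaw W_A (expMeasure 1) P ∧
      ∀ᵐ ω ∂P, Tendsto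
        (fun n : ℕ => (n : ℝ) /
          Real.exp ((2 + δ) * BranchingTimes.branchTimeA (fun i t => BI i t ω) n))
        atTop (𝓝 (W_A ω))) ∧
    (∃ W_B : Ω → ℝ, HasLaw W_B (gammaMeasure ((3 + 2 * δ) / (2 + δ)) 1) P ∧
      ∀ᵐ ω ∂P, Tendsto
        (fun n : ℕ => (n : ℝ) /
          Real.exp ((2 + δ) * BranchingTimes.branchTimeB (fun i t => BI i t ω) n))
        atTop (𝓝 (W_B ω))) := by
  have hX : ∀ i : ℕ, BranchingTimes.IsBIProcess P (BI i.succPNat)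
      (BranchingTimes.initialState i) δ
    | 0 => hBI_one
    | i + 1 => hBI _ (Nat.le_add_left 2 i)
  have hlaw := BranchingTimes.hasLaw_holdingTime_of_isBIProcess hX
    (hindep.precomp Nat.succPNat_injective)
  have hpos := BranchingTimes.initialState_add_pos hδ
  have hδ' : 0 < 2 + δ := by linarith
  have hrateA : ∀ j : ℕ, ∑ i ∈ Finset.range (1 + j), (BranchingTimes.initialState i + δ) + j =
      (2 + δ) * (1 + j) := fun j => by
    rw [add_comm 1 j, BranchingTimes.sum_range_initialState_add]
    ring
  have hrateB : ∀ j : ℕ, ∑ i ∈ Finset.range (2 + j), (BranchingTimes.initialState i + δ) + j =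
      (2 + δ) * ((3 + 2 * δ) / (2 + δ) + j) := fun j => by
    rw [show 2 + j = j + 1 + 1 by ring, BranchingTimes.sum_range_initialState_add]
    field_simp
    push_cast
    ring
  exact ⟨BranchingTimes.exists_hasLaw_gammaMeasure_tendsto_of_isBranching hpos one_pos hδ' one_pos
      hrateA hlaw fun ω => BranchingTimes.isBranching_branchTimeA fun i t => BI i t ω,
    BranchingTimes.exists_hasLaw_gammaMeasure_tendsto_of_isBranching hpos two_pos hδ'
      (div_pos (by linarith) hδ') hrateB hlaw
      fun ω => BranchingTimes.isBranching_branchTimeB fun i t => BI i t ω⟩
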